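/- Let $\beta>1$ and $I=[0,1)$, and let $T_\beta\colon I\to I$, $T_\beta x=\beta x-\lfloor\beta x\rfloor$, be the $\beta$-transformation. For $x\in I$ and $n\ge1$ let $\varepsilon_n(x,\beta)=\lfloor\beta T_\beta^{n-1}x\rfloor$ be the $n$-th digit of the $\beta$-expansion of $x$, and for $y\in I$ let $$I_n(y)=\{x\in I\colon \varepsilon_i(x,\beta)=\varepsilon_i(y,\beta),\ 1\le i\le n\}.$$ For $x,y\in I$ define the waiting time $$W_n^\beta(x,y)=\inf\{k\ge1\colon T_\beta^kx\in I_n(y)\}\in\{1,2,\ldots\}\cup\{\infty\},\qquad \inf\emptyset=\infty,$$ and, with $\log\infty=\infty$, the lower and upper quantitative waiting time indicators $$\underline R^\beta(x,y)=\liminf_{n\to\infty}\frac{\log W_n^\beta(x,y)}{n},\qquad \overline R^\beta(x,y)=\limsup_{n\to\infty}\frac{\log W_n^\beta(x,y)}{n}.$$ If they coincide, their common value in $[0,\infty]$ is denoted by $R^\beta(x,y)$. Then for every $\beta>1$ and every $0\le a\le\infty$, the level set $$E_\beta(a)=\{(x,y)\in I^2\colon R^\beta(x,y)\text{ exists and equals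 }a\}\subset\mathbb R^2$$ has Hausdorff dimension $2$. -/

import Mathlib

open Set Filter
open scoped ENNReal

namespace BetaWaiting

noncomputable section

/-- The `β`-transformation `T_β x = βx - [βx]`. -/
def T (β : ℝ) (x : ℝ) : ℝ := β * x - ⌊β * x⌋

/-- The `n`-th digit `[β T_β^{n-1} x]` of the `β`-expansion of `x`, for `n ≥ 1`. -/
def digit (β : ℝ) (n : ℕ) (x : ℝ) : ℤ := ⌊β * (T β)^[n - 1] x⌋

/-- The basic interval `I_n(y)` of order `n` containing `y`: the points of `[0,1)` whose first `n`
digits are those of `y`. -/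
def basicInterval (β : ℝ) (n : ℕ) (y : ℝ) : Set ℝ :=
  {x | x ∈ Ico (0 : ℝ) 1 ∧ ∀ i ∈ Finset.Icc 1 n, digit β i x = digit β i y}

/-- The waiting time `W_n(x,y) = inf {k ≥ 1 : T_β^k x ∈ I_n(y)}`, with `inf ∅ = ∞`. -/
def waitingTime (β : ℝ) (n : ℕ) (x y : ℝ) : ℕ∞ :=
  sInf ((fun k : ℕ => (k : ℕ∞)) '' {k : ℕ | 1 ≤ k ∧ (T β)^[k] x ∈ basicInterval β n y})

/-- `log W_n(x,y) / n` as an extended real number, where `log ∞ = ∞`. -/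
def waitingRate (β : ℝ) (x y : ℝ) (n : ℕ) : EReal :=
  ENNReal.log (waitingTime β n x y : ℝ≥0∞) / (n : EReal)

/-- The lower quantitative waiting time indicator of `y` by `x`. -/
def lowerIndicator (β : ℝ) (x y : ℝ) : EReal := liminf (waitingRate β x y) atTop

/-- The upper quantitative waiting time indicator of `y` by `x`. -/
def upperIndicator (β : ℝ) (x y : ℝ) : EReal := limsup (waitingRate β x y) atTop

/-- The waiting time indicator of `y` by `x` exists and equals `a`. -/
def IndicatorEq (β : ℝ) (x y : ℝ) (a : EReal) : Prop :=
  lowerIndicator β x y = a ∧ upperIndicator β x y = a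

/-- The level set of the waiting time indicator in the unit square `[0,1)²`, as a subset of the
Euclidean plane. -/
def levelSet (β : ℝ) (a : ℝ≥0∞) : Set (EuclideanSpace ℝ (Fin 2)) :=
  {p | p 0 ∈ Ico (0 : ℝ) 1 ∧ p 1 ∈ Ico (0 : ℝ) 1 ∧ IndicatorEq β (p 0) (p 1) (a : EReal)}

end

end BetaWaiting

/-!
Full words can be concatenated freely, and those of length `n` number at least `βⁿ / (n + 1)`,
since the intervals of length `β⁻ⁿ` that end at the right ends of the cylinders of their prefixes
cover `[0, 1)`. So two arbitrary sequences of letters, coded by full words of a fixed large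
length, describe pairs of points forming a set of dimension close to `2`.

To prescribe the waiting time, put two blanks (zero words) in front of the target `y`, and insert
into the source `x`, at sparse places `p k`, the first letters of the target closed by a blank.
Every letter other than the blank has a nonzero digit at a marked place, so two consecutive blanks
occur in `x` only at the start of a copy, and the closing blank stops the match there; hence `p k`
controls `Wₙ(x, y)` when `n` is about `k` words long, and `log p k ≈ a n` gives the rate `a` (for
`a = ∞`, any superlinear growth does).

As soon as `p k` exceeds `D k²` for a large constant `D`, the copies occupy a small proportion of
the places, so the two sequences are recovered from `(x, y)` by a Hölder map of exponent close to
`1`.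
-/

namespace BetaWaiting

noncomputable section

/-! ### The beta-transformation and its inverse branches -/

/-- The digit sequence of the `β`-expansion of `x`, indexed from `0`. -/
def expansion (β x : ℝ) (i : ℕ) : ℤ := digit β (i + 1) x

/-- The inverse branch of `T β ^[n]` with digit word `w 0, …, w (n - 1)`. -/
def branch (β : ℝ) (n : ℕ) (w : ℕ → ℤ) (t : ℝ) : ℝ :=
  ∑ i ∈ Finset.range n, (w i : ℝ) * β⁻¹ ^ (i + 1) + t * β⁻¹ ^ n

/-- The cylinder of the word `w 0, …, w (n - 1)` is mapped by `T β ^[n]` onto a set containing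
`[0, s)`; this is phrased through the inverse branch. -/
def IsFullUpTo (β : ℝ) (n : ℕ) (w : ℕ → ℤ) (s : ℝ) : Prop :=
  ∀ t ∈ Ico 0 s, branch β n w t ∈ Ico (0 : ℝ) 1 ∧ ∀ i < n, expansion β (branch β n w t) i = w i

/-- A word is full if its cylinder is mapped onto `[0, 1)` by `T β ^[n]`. -/
abbrev IsFull (β : ℝ) (n : ℕ) (w : ℕ → ℤ) : Prop := IsFullUpTo β n w 1

variable {β x y s t : ℝ} {m n : ℕ} {w w' : ℕ → ℤ}

lemma T_mem_Ico (β x : ℝ) : T β x ∈ Ico (0 : ℝ) 1 := ⟨Int.fract_nonneg _, Int.fract_lt_one _⟩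

lemma iterate_T_mem_Ico (β : ℝ) (hx : x ∈ Ico (0 : ℝ) 1) (n : ℕ) : (T β)^[n] x ∈ Ico (0 : ℝ) 1 :=
  Set.MapsTo.iterate (fun _ _ => T_mem_Ico β _) n hx

lemma expansion_eq_floor (β x : ℝ) (n : ℕ) : expansion β x n = ⌊β * (T β)^[n] x⌋ := rfl

lemma expansion_iterate_T (β x : ℝ) (s i : ℕ) :
    expansion β ((T β)^[s] x) i = expansion β x (s + i) := by
  rw [expansion_eq_floor, expansion_eq_floor, add_comm s i, Function.iterate_add_apply]

lemma iterate_T_succ (β x : ℝ) (n : ℕ) :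
    (T β)^[n + 1] x = β * (T β)^[n] x - expansion β x n :=
  Function.iterate_succ_apply' _ _ _

lemma expansion_mem_Icc (hβ : 0 ≤ β) (hx : x ∈ Ico (0 : ℝ) 1) (n : ℕ) :
    expansion β x n ∈ Icc 0 ⌊β⌋ := by
  have hTx := iterate_T_mem_Ico β hx n
  exact ⟨Int.floor_nonneg.2 (mul_nonneg hβ hTx.1),
    Int.floor_le_floor (mul_le_of_le_one_right hβ hTx.2.le)⟩

lemma mem_basicInterval_iff : x ∈ basicInterval β n y ↔
    x ∈ Ico (0 : ℝ) 1 ∧ ∀ i < n, expansion β x i = expansion β y i := by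
  refine and_congr_right fun _ => ⟨fun h i hi => h _ (Finset.mem_Icc.2 (by omega)),
    fun h i hi => ?_⟩
  obtain ⟨h1, hn⟩ := Finset.mem_Icc.1 hi
  simpa only [expansion, Nat.sub_add_cancel h1] using h (i - 1) (by omega)

@[simp] lemma branch_zero (β : ℝ) (w : ℕ → ℤ) (t : ℝ) : branch β 0 w t = t := by simp [branch]

lemma branch_congr (h : ∀ i < n, w i = w' i) (t : ℝ) : branch β n w t = branch β n w' t := by
  unfold branch
  rw [Finset.sum_congr rfl fun i hi => by rw [h i (Finset.mem_range.1 hi)]]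

lemma branch_sub_branch (β : ℝ) (n : ℕ) (w : ℕ → ℤ) (s t : ℝ) :
    branch β n w s - branch β n w t = (s - t) * β⁻¹ ^ n := by
  unfold branch; ring

lemma branch_monotone (hβ : 0 ≤ β) (n : ℕ) (w : ℕ → ℤ) : Monotone (branch β n w) := fun _ _ h =>
  add_le_add_right (mul_le_mul_of_nonneg_right h (by positivity)) _

lemma branch_injective (hβ : 0 < β) (n : ℕ) (w : ℕ → ℤ) : Function.Injective (branch β n w) := by
  intro s t hst
  have hzero := branch_sub_branch β n w s t
  rw [hst, sub_self, eq_comm, mul_eq_zero] at hzero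
  exact sub_eq_zero.1 (hzero.resolve_right (by positivity))

lemma branch_add (β : ℝ) (m n : ℕ) (w : ℕ → ℤ) (t : ℝ) :
    branch β (m + n) w t = branch β m w (branch β n (fun i => w (m + i)) t) := by
  unfold branch
  rw [Finset.sum_range_add, add_mul, Finset.sum_mul, add_assoc, pow_add]
  congr 2
  · exact Finset.sum_congr rfl fun i _ => by ring
  · ring

lemma branch_succ (β : ℝ) (n : ℕ) (w : ℕ → ℤ) (t : ℝ) :
    branch β (n + 1) w t = branch β n w ((w n + t) / β) := by
  rw [branch_add]
  simp [branch, div_eq_mul_inv, add_mul]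

lemma branch_expansion (hβ : β ≠ 0) (x : ℝ) (n : ℕ) :
    branch β n (expansion β x) ((T β)^[n] x) = x := by
  induction n with
  | zero => simp
  | succ n ih => rw [branch_succ, iterate_T_succ, add_sub_cancel, mul_div_cancel_left₀ _ hβ, ih]

lemma iterate_T_branch (hβ : 0 < β) (h : ∀ i < n, expansion β (branch β n w t) i = w i) :
    (T β)^[n] (branch β n w t) = t := by
  have hb := branch_expansion hβ.ne' (branch β n w t) n
  rw [branch_congr h] at hb
  exact branch_injective hβ n w hb

/-! ### Full words -/

lemma IsFullUpTo.congr (h : IsFullUpTo β n w s) (hw : ∀ i < n, w i = w' i) :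
    IsFullUpTo β n w' s := by
  intro t ht
  rw [← branch_congr hw]
  exact ⟨(h t ht).1, fun i hi => by rw [(h t ht).2 i hi, hw i hi]⟩

lemma isFullUpTo_zero_length (β : ℝ) (w : ℕ → ℤ) (hs : s ≤ 1) : IsFullUpTo β 0 w s := by
  intro t ht
  simpa using Ico_subset_Ico_right hs ht

lemma IsFull.append (hβ : 0 < β) (h : IsFull β m w)
    (h' : IsFullUpTo β n (fun i => w (m + i)) s) : IsFullUpTo β (m + n) w s := by
  intro t ht
  rw [branch_add]
  obtain ⟨hmem, hexp⟩ := h' t ht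
  refine ⟨(h _ hmem).1, fun i hi => ?_⟩
  rcases lt_or_ge i m with him | him
  · exact (h _ hmem).2 i him
  · obtain ⟨r, rfl⟩ := Nat.exists_eq_add_of_le him
    rw [← expansion_iterate_T, iterate_T_branch hβ (h _ hmem).2]
    exact hexp r (by omega)

lemma IsFullUpTo.succ (hβ : 0 < β) (h : IsFullUpTo β n w s) (hw : 0 ≤ w n) (ht1 : t ≤ 1)
    (ht : w n + t ≤ β * s) : IsFullUpTo β (n + 1) w t := by
  intro u hu
  have hw' : (0 : ℝ) ≤ w n := by exact_mod_cast hw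
  have hv : (w n + u) / β ∈ Ico 0 s :=
    ⟨div_nonneg (by linarith [hu.1]) hβ.le, by rw [div_lt_iff₀ hβ]; linarith [hu.2]⟩
  rw [branch_succ]
  obtain ⟨hmem, hexp⟩ := h _ hv
  refine ⟨hmem, fun i hi => ?_⟩
  rcases Nat.lt_succ_iff_lt_or_eq.1 hi with hi | rfl
  · exact hexp i hi
  · rw [expansion_eq_floor, iterate_T_branch hβ hexp, mul_div_cancel₀ _ hβ.ne', Int.floor_eq_iff]
    constructor <;> linarith [hu.1, hu.2]

lemma isFull_zero (hβ : 1 ≤ β) (n : ℕ) : IsFull β n 0 := by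
  induction n with
  | zero => exact isFullUpTo_zero_length _ _ le_rfl
  | succ n ih => exact ih.succ (by linarith) le_rfl le_rfl (by simpa using hβ)

lemma isFullUpTo_single_one (hβ : 1 < β) (n : ℕ) :
    IsFullUpTo β (n + 1) (Pi.single 0 1) (min 1 (β ^ n * (β - 1))) := by
  have hβ0 : 0 < β := by linarith
  induction n with
  | zero =>
    refine (isFullUpTo_zero_length β _ le_rfl).succ hβ0 (by simp) (min_le_left _ _) ?_
    have := min_le_right (1 : ℝ) (β ^ 0 * (β - 1))
    simp only [Pi.single_eq_same, Int.cast_one, pow_zero, one_mul, mul_one] at this ⊢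
    linarith
  | succ n ih =>
    refine ih.succ hβ0 (by simp) (min_le_left _ _) ?_
    rw [Pi.single_eq_of_ne n.succ_ne_zero, Int.cast_zero, zero_add, mul_min_of_nonneg _ _ hβ0.le,
      mul_one]
    exact min_le_min hβ.le (by rw [pow_succ']; exact (mul_assoc _ _ _).le)

lemma exists_isFull_single_one (hβ : 1 < β) : ∃ n, IsFull β (n + 1) (Pi.single 0 1) := by
  obtain ⟨n, hn⟩ := pow_unbounded_of_one_lt (1 / (β - 1)) hβ
  have hle : 1 ≤ β ^ n * (β - 1) := ((div_lt_iff₀ (by linarith)).1 hn).le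
  exact ⟨n, by simpa only [min_eq_left hle] using isFullUpTo_single_one hβ n⟩

lemma IsFull.branch_succ_one_lt_one (hβ : 1 < β) (h : IsFull β n w) (hw : w n = 0) :
    branch β (n + 1) w 1 < 1 := by
  rw [branch_succ, hw]
  refine (h _ ⟨by positivity, ?_⟩).1.2
  simpa using inv_lt_one_of_one_lt₀ hβ

lemma IsFull.eq_of_branch_eq (h : IsFull β n w) (h' : IsFull β n w') (hs : s ∈ Ico (0 : ℝ) 1)
    (ht : t ∈ Ico (0 : ℝ) 1) (heq : branch β n w s = branch β n w' t) : ∀ i < n, w i = w' i := by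
  intro i hi
  rw [← (h s hs).2 i hi, heq, (h' t ht).2 i hi]

lemma IsFull.branch_one_le_branch_zero (hβ : 0 < β) (h : IsFull β n w) (h' : IsFull β n w')
    (hne : ¬ ∀ i < n, w i = w' i) (hle : branch β n w 0 ≤ branch β n w' 0) :
    branch β n w 1 ≤ branch β n w' 0 := by
  by_contra! hlt
  have hpos : 0 < β⁻¹ ^ n := by positivity
  have hlen := branch_sub_branch β n w 1 0
  set s := (branch β n w' 0 - branch β n w 0) / β⁻¹ ^ n with hs
  have hs01 : s ∈ Ico (0 : ℝ) 1 :=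
    ⟨div_nonneg (by linarith) hpos.le, by rw [hs, div_lt_one hpos]; linarith⟩
  have hsub := branch_sub_branch β n w s 0
  rw [sub_zero, hs, div_mul_cancel₀ _ hpos.ne', sub_left_inj] at hsub
  exact hne (h.eq_of_branch_eq h' hs01 ⟨le_rfl, one_pos⟩ hsub)

/-! ### Counting full words -/

/-- The length of the image under `T β ^[n]` of the cylinder of order `n` around `x`. This image is
an interval `[0, s)`: the step from `n` to `n + 1` stretches it by `β`, translates it and cuts it at
the next integer. -/
def reach (β x : ℝ) : ℕ → ℝ
  | 0 => 1
  | n + 1 => min 1 (β * reach β x n - expansion β x n)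

lemma reach_le_one (β x : ℝ) (n : ℕ) : reach β x n ≤ 1 := by
  cases n with
  | zero => exact le_rfl
  | succ n => exact min_le_left _ _

lemma iterate_T_lt_reach (hβ : 0 < β) (hx : x ∈ Ico (0 : ℝ) 1) (n : ℕ) :
    (T β)^[n] x < reach β x n := by
  induction n with
  | zero => exact hx.2
  | succ n ih =>
    refine lt_min (iterate_T_mem_Ico β hx _).2 ?_
    rw [iterate_T_succ]
    exact sub_lt_sub_right (mul_lt_mul_of_pos_left ih hβ) _

lemma isFullUpTo_reach (hβ : 0 < β) (hx : x ∈ Ico (0 : ℝ) 1) (n : ℕ) :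
    IsFullUpTo β n (expansion β x) (reach β x n) := by
  induction n with
  | zero => exact isFullUpTo_zero_length _ _ le_rfl
  | succ n ih =>
    refine ih.succ hβ (expansion_mem_Icc hβ.le hx n).1 (reach_le_one β x _) ?_
    rw [add_comm, ← le_sub_iff_add_le]
    exact min_le_right _ _

/-- The right end of the cylinder of order `n` around `x` is inherited from the last order `k ≤ n`
at which the image was cut, and there the image is all of `[0, 1)`. -/
lemma exists_reach_eq_one (hβ : 0 < β) (x : ℝ) (n : ℕ) :
    ∃ k ≤ n, reach β x k = 1 ∧
      (1 - (T β)^[k] x) * β⁻¹ ^ k = (reach β x n - (T β)^[n] x) * β⁻¹ ^ n := by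
  induction n with
  | zero => exact ⟨0, le_rfl, rfl, rfl⟩
  | succ n ih =>
    obtain ⟨k, hkn, hk, heq⟩ := ih
    rcases le_total 1 (β * reach β x n - expansion β x n) with hcut | hcut
    · have hone : reach β x (n + 1) = 1 := min_eq_left hcut
      exact ⟨n + 1, le_rfl, hone, by rw [hone]⟩
    · refine ⟨k, by omega, hk, heq.trans ?_⟩
      rw [reach, min_eq_right hcut, iterate_T_succ, sub_sub_sub_cancel_right, ← mul_sub, pow_succ',
        ← mul_assoc, mul_right_comm β, mul_inv_cancel₀ hβ.ne', one_mul]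

lemma exists_isFull_expansion (hβ : 0 < β) (hx : x ∈ Ico (0 : ℝ) 1) (n : ℕ) :
    ∃ k ≤ n, IsFull β k (expansion β x) ∧
      branch β k (expansion β x) 1 - x ∈ Ioc 0 (β⁻¹ ^ n) := by
  obtain ⟨k, hkn, hk, heq⟩ := exists_reach_eq_one hβ x n
  have hfull := isFullUpTo_reach hβ hx k
  rw [hk] at hfull
  refine ⟨k, hkn, hfull, ?_⟩
  have hdist := branch_sub_branch β k (expansion β x) 1 ((T β)^[k] x)
  rw [branch_expansion hβ.ne', heq] at hdist
  have hpow : 0 < β⁻¹ ^ n := by positivity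
  rw [hdist]
  exact ⟨mul_pos (sub_pos.2 (iterate_T_lt_reach hβ hx n)) hpow, mul_le_of_le_one_left hpow.le
    (by linarith [reach_le_one β x n, (iterate_T_mem_Ico β hx n).1])⟩

/-- The full words of length `n`, continued by zeros so that a word is determined by its letters. -/
def fullWords (β : ℝ) (n : ℕ) : Set (ℕ → ℤ) := {w | IsFull β n w ∧ ∀ i, n ≤ i → w i = 0}

lemma fullWords_finite (hβ : 0 ≤ β) (n : ℕ) : (fullWords β n).Finite := by
  have hmaps : MapsTo (fun w (i : Fin n) => w i) (fullWords β n) {f | ∀ i, f i ∈ Icc 0 ⌊β⌋} := by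
    intro w hw i
    obtain ⟨hmem, hexp⟩ := hw.1 0 ⟨le_rfl, one_pos⟩
    simpa only [hexp i i.2] using expansion_mem_Icc hβ hmem i
  refine Finite.of_injOn hmaps ?_ (Finite.pi' fun _ => finite_Icc 0 ⌊β⌋)
  intro w hw w' hw' heq
  funext i
  rcases lt_or_ge i n with hi | hi
  · exact congrFun heq ⟨i, hi⟩
  · rw [hw.2 i hi, hw'.2 i hi]

lemma exists_mem_fullWords (hβ : 1 ≤ β) (hx : x ∈ Ico (0 : ℝ) 1) (n : ℕ) :
    ∃ k ≤ n, ∃ w ∈ fullWords β n, branch β k w 1 - x ∈ Ioc 0 (β⁻¹ ^ n) := by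
  have hβ0 : 0 < β := by linarith
  obtain ⟨k, hkn, hfull, hmem⟩ := exists_isFull_expansion hβ0 hx n
  set w : ℕ → ℤ := fun i => if i < k then expansion β x i else 0
  have hprefix : ∀ i < k, expansion β x i = w i := fun i hi => (if_pos hi).symm
  have hzero : ∀ i, k ≤ i → w i = 0 := fun i hi => if_neg hi.not_gt
  refine ⟨k, hkn, w, ⟨?_, fun i hi => hzero i (hkn.trans hi)⟩, branch_congr hprefix 1 ▸ hmem⟩
  rw [← Nat.add_sub_of_le hkn]
  refine IsFull.append hβ0 (hfull.congr hprefix) ((isFull_zero hβ (n - k)).congr fun i _ => ?_)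
  exact (hzero _ (Nat.le_add_right _ _)).symm

lemma pow_le_mul_ncard_fullWords (hβ : 1 ≤ β) (n : ℕ) :
    β ^ n ≤ (n + 1) * (fullWords β n).ncard := by
  have hβ0 : 0 < β := by linarith
  have hfin := fullWords_finite hβ0.le n
  let J : ℕ → (ℕ → ℤ) → Set ℝ := fun k w => Ico (branch β k w 1 - β⁻¹ ^ n) (branch β k w 1)
  have hcover : Ico 0 1 ⊆ ⋃ k ∈ Finset.range (n + 1), ⋃ w ∈ hfin.toFinset, J k w := by
    intro x hx
    obtain ⟨k, hk, w, hw, hpos, hle⟩ := exists_mem_fullWords hβ hx n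
    simp only [mem_iUnion, exists_prop]
    exact ⟨k, Finset.mem_range_succ_iff.2 hk, w, hfin.mem_toFinset.2 hw, by linarith, by linarith⟩
  have hbounded : Bornology.IsBounded (⋃ k ∈ Finset.range (n + 1), ⋃ w ∈ hfin.toFinset, J k w) :=
    (Bornology.isBounded_biUnion (Finset.finite_toSet _)).2 fun k _ =>
      (Bornology.isBounded_biUnion (Finset.finite_toSet _)).2 fun w _ => Metric.isBounded_Ico _ _
  have hvolume : 1 ≤ (n + 1) * ((fullWords β n).ncard * β⁻¹ ^ n) :=
    calc 1 = MeasureTheory.volume.real (Ico (0 : ℝ) 1) := by simp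
      _ ≤ MeasureTheory.volume.real (⋃ k ∈ Finset.range (n + 1), ⋃ w ∈ hfin.toFinset, J k w) :=
        MeasureTheory.measureReal_mono hcover hbounded.measure_lt_top.ne
      _ ≤ ∑ k ∈ Finset.range (n + 1), ∑ w ∈ hfin.toFinset, MeasureTheory.volume.real (J k w) :=
        (MeasureTheory.measureReal_biUnion_finset_le _ _).trans
          (Finset.sum_le_sum fun k _ => MeasureTheory.measureReal_biUnion_finset_le _ _)
      _ = (n + 1) * ((fullWords β n).ncard * β⁻¹ ^ n) := by
        simp [J, pow_nonneg hβ0.le n, ncard_eq_toFinset_card _ hfin]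
  rwa [inv_pow, ← div_eq_mul_inv, ← mul_div_assoc, one_le_div (by positivity)] at hvolume

/-! ### Block codes -/

/-- A code of the letters `Option α` by digit words of a common length. The letter `none`, the
blank, is coded by zeros, the other letters by words with a nonzero digit at the place `mark`. All
words are full, so they can be concatenated freely, and their cylinders do not reach up to `1`. -/
structure BlockCode (β : ℝ) (α : Type*) where
  len : ℕ
  mark : ℕ
  mark_lt : mark < len
  word : Option α → ℕ → ℤ
  isFull : ∀ o, IsFull β len (word o)
  branch_one_lt_one : ∀ o, branch β len (word o) 1 < 1
  word_none : word none = 0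
  word_some_mark : ∀ a, word (some a) mark ≠ 0
  eq_of_word_some_eq : ∀ a b, (∀ i < len, word (some a) i = word (some b) i) → a = b

namespace BlockCode

variable {α : Type*} (C : BlockCode β α)

lemma len_pos : 0 < C.len := C.mark_lt.pos

lemma word_mark_eq_zero_iff {o : Option α} : C.word o C.mark = 0 ↔ o = none := by
  cases o with
  | none => simp [C.word_none]
  | some a => simp [C.word_some_mark]

lemma eq_of_word_eq {o o' : Option α} (h : ∀ i < C.len, C.word o i = C.word o' i) : o = o' := by
  have hmark : o = none ↔ o' = none := by
    rw [← C.word_mark_eq_zero_iff, h _ C.mark_lt, C.word_mark_eq_zero_iff]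
  cases o with
  | none => exact (hmark.1 rfl).symm
  | some a =>
    cases o' with
    | none => exact hmark.2 rfl
    | some b => exact congrArg some (C.eq_of_word_some_eq a b h)

/-- The concatenation of the words coding `ω 0`, `ω 1`, … -/
def concat (ω : ℕ → Option α) (i : ℕ) : ℤ := C.word (ω (i / C.len)) (i % C.len)

lemma concat_len_mul_add (ω : ℕ → Option α) (q i : ℕ) :
    C.concat ω (C.len * q + i) = C.concat (fun j => ω (q + j)) i := by
  unfold concat
  rw [Nat.mul_add_div C.len_pos, Nat.mul_add_mod]

lemma concat_of_lt (ω : ℕ → Option α) {i : ℕ} (hi : i < C.len) : C.concat ω i = C.word (ω 0) i := by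
  rw [concat, Nat.div_eq_of_lt hi, Nat.mod_eq_of_lt hi]

lemma concat_congr {ω ω' : ℕ → Option α} {n i : ℕ} (h : ∀ q < n, ω q = ω' q)
    (hi : i < C.len * n) : C.concat ω i = C.concat ω' i := by
  rw [concat, h _ (Nat.div_lt_of_lt_mul hi), concat]

lemma concat_mark_eq_zero_iff {ω : ℕ → Option α} {q : ℕ} :
    C.concat ω (C.len * q + C.mark) = 0 ↔ ω q = none := by
  rw [concat_len_mul_add, concat_of_lt _ _ C.mark_lt, word_mark_eq_zero_iff, add_zero]

/-- The factor by which the branch of a code word contracts. -/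
def ratio : ℝ := β⁻¹ ^ C.len

lemma ratio_pos (hβ : 0 < β) : 0 < C.ratio := pow_pos (inv_pos.2 hβ) _

lemma ratio_lt_one (hβ : 1 < β) : C.ratio < 1 :=
  pow_lt_one₀ (inv_nonneg.2 (by linarith)) (inv_lt_one_of_one_lt₀ hβ) C.len_pos.ne'

lemma branch_sub_branch (o : Option α) (s t : ℝ) :
    branch β C.len (C.word o) s - branch β C.len (C.word o) t = (s - t) * C.ratio :=
  BetaWaiting.branch_sub_branch β C.len (C.word o) s t

lemma branch_zero_nonneg (o : Option α) : 0 ≤ branch β C.len (C.word o) 0 :=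
  (C.isFull o 0 ⟨le_rfl, one_pos⟩).1.1

lemma branch_zero_le (o : Option α) : branch β C.len (C.word o) 0 ≤ 1 - C.ratio := by
  linarith [C.branch_sub_branch o 1 0, C.branch_one_lt_one o]

/-- The point whose expansion is the concatenation of the words coding `ω 0`, `ω 1`, … -/
def point (ω : ℕ → Option α) : ℝ := ∑' q, branch β C.len (C.word (ω q)) 0 * C.ratio ^ q

lemma summable_point (hβ : 1 < β) (ω : ℕ → Option α) :
    Summable fun q => branch β C.len (C.word (ω q)) 0 * C.ratio ^ q := by
  have hratio := (C.ratio_pos (one_pos.trans hβ)).le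
  exact Summable.of_nonneg_of_le
    (fun q => mul_nonneg (C.branch_zero_nonneg _) (pow_nonneg hratio q))
    (fun q => mul_le_mul_of_nonneg_right (C.branch_zero_le _) (pow_nonneg hratio q))
    ((summable_geometric_of_lt_one hratio (C.ratio_lt_one hβ)).mul_left _)

lemma point_eq_branch (hβ : 1 < β) (ω : ℕ → Option α) :
    C.point ω = branch β C.len (C.word (ω 0)) (C.point fun q => ω (q + 1)) := by
  have htail : ∑' q, branch β C.len (C.word (ω (q + 1))) 0 * C.ratio ^ (q + 1) =
      (C.point fun q => ω (q + 1)) * C.ratio := by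
    rw [point, ← tsum_mul_right]
    exact tsum_congr fun q => by ring
  rw [point, (C.summable_point hβ ω).tsum_eq_zero_add, htail]
  linarith [C.branch_sub_branch (ω 0) (C.point fun q => ω (q + 1)) 0]

lemma point_nonneg (hβ : 0 < β) (ω : ℕ → Option α) : 0 ≤ C.point ω :=
  tsum_nonneg fun _ => mul_nonneg (C.branch_zero_nonneg _) (pow_nonneg (C.ratio_pos hβ).le _)

lemma point_le_one (hβ : 1 < β) (ω : ℕ → Option α) : C.point ω ≤ 1 := by
  have hratio := (C.ratio_pos (one_pos.trans hβ)).le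
  have hratio1 := C.ratio_lt_one hβ
  have hsum := (C.summable_point hβ ω).tsum_le_tsum
    (fun q => mul_le_mul_of_nonneg_right (C.branch_zero_le _) (pow_nonneg hratio q))
    ((summable_geometric_of_lt_one hratio hratio1).mul_left _)
  rwa [tsum_mul_left, tsum_geometric_of_lt_one hratio hratio1,
    mul_inv_cancel₀ (sub_pos.2 hratio1).ne'] at hsum

lemma point_le_branch_one (hβ : 1 < β) (ω : ℕ → Option α) :
    C.point ω ≤ branch β C.len (C.word (ω 0)) 1 := by
  rw [C.point_eq_branch hβ]
  exact branch_monotone (by linarith) _ _ (C.point_le_one hβ _)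

lemma point_mem_Ico (hβ : 1 < β) (ω : ℕ → Option α) : C.point ω ∈ Ico (0 : ℝ) 1 :=
  ⟨C.point_nonneg (by linarith) ω, (C.point_le_branch_one hβ ω).trans_lt (C.branch_one_lt_one _)⟩

lemma iterate_T_point (hβ : 1 < β) (ω : ℕ → Option α) (q : ℕ) :
    (T β)^[C.len * q] (C.point ω) = C.point fun i => ω (q + i) := by
  induction q with
  | zero => simp
  | succ q ih =>
    rw [Nat.mul_succ, add_comm, Function.iterate_add_apply, ih, C.point_eq_branch hβ,
      iterate_T_branch (by linarith) (C.isFull _ _ (C.point_mem_Ico hβ _)).2]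
    congr 1
    funext i
    rw [add_comm i 1, add_assoc]

lemma expansion_point (hβ : 1 < β) (ω : ℕ → Option α) : expansion β (C.point ω) = C.concat ω := by
  funext i
  have hmod := Nat.mod_lt i C.len_pos
  rw [← Nat.div_add_mod i C.len, ← expansion_iterate_T, C.iterate_T_point hβ,
    C.concat_len_mul_add, C.concat_of_lt _ hmod, C.point_eq_branch hβ]
  exact (C.isFull _ _ (C.point_mem_Ico hβ _)).2 _ hmod

/-- The distance from `1` of the cylinders of the code words. -/
def gap : ℝ := ⨅ o, (1 - branch β C.len (C.word o) 1)

variable [Finite α]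

lemma gap_pos : 0 < C.gap := by
  obtain ⟨o, ho⟩ := exists_eq_ciInf_of_finite (f := fun o => 1 - branch β C.len (C.word o) 1)
  rw [gap, ← ho]
  exact sub_pos.2 (C.branch_one_lt_one o)

lemma point_le_one_sub_gap (hβ : 1 < β) (ω : ℕ → Option α) : C.point ω ≤ 1 - C.gap := by
  have hgap : C.gap ≤ 1 - branch β C.len (C.word (ω 0)) 1 := ciInf_le (finite_range _).bddBelow _
  linarith [C.point_le_branch_one hβ ω]

lemma gap_mul_ratio_le_sub (hβ : 1 < β) {ω ω' : ℕ → Option α} (hne : ω 0 ≠ ω' 0)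
    (hle : branch β C.len (C.word (ω 0)) 0 ≤ branch β C.len (C.word (ω' 0)) 0) :
    C.gap * C.ratio ≤ C.point ω' - C.point ω := by
  have hβ0 : 0 < β := by linarith
  have hdisjoint := (C.isFull (ω 0)).branch_one_le_branch_zero hβ0 (C.isFull (ω' 0))
    (fun h => hne (C.eq_of_word_eq h)) hle
  have hright : branch β C.len (C.word (ω' 0)) 0 ≤ C.point ω' := by
    rw [C.point_eq_branch hβ]
    exact branch_monotone hβ0.le _ _ (C.point_nonneg hβ0 _)
  have hleft : C.gap * C.ratio ≤ branch β C.len (C.word (ω 0)) 1 - C.point ω := by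
    rw [C.point_eq_branch hβ, C.branch_sub_branch]
    exact mul_le_mul_of_nonneg_right (by linarith [C.point_le_one_sub_gap hβ fun q => ω (q + 1)])
      (C.ratio_pos hβ0).le
  linarith

lemma gap_mul_ratio_le_abs_sub (hβ : 1 < β) {ω ω' : ℕ → Option α} (hne : ω 0 ≠ ω' 0) :
    C.gap * C.ratio ≤ |C.point ω - C.point ω'| := by
  rcases le_total (branch β C.len (C.word (ω 0)) 0) (branch β C.len (C.word (ω' 0)) 0) with h | h
  · rw [abs_sub_comm]
    exact (C.gap_mul_ratio_le_sub hβ hne h).trans (le_abs_self _)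
  · exact (C.gap_mul_ratio_le_sub hβ hne.symm h).trans (le_abs_self _)

lemma eq_of_abs_point_sub_lt (hβ : 1 < β) {n : ℕ} {ω ω' : ℕ → Option α}
    (h : |C.point ω - C.point ω'| < C.gap * C.ratio ^ n) : ∀ q < n, ω q = ω' q := by
  have hratio := C.ratio_pos (one_pos.trans hβ)
  induction n generalizing ω ω' with
  | zero => exact fun q hq => absurd hq q.not_lt_zero
  | succ n ih =>
    have hhead : ω 0 = ω' 0 := by
      by_contra hne
      have hpow : C.ratio ^ (n + 1) ≤ C.ratio :=
        pow_le_of_le_one hratio.le (C.ratio_lt_one hβ).le n.succ_ne_zero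
      exact (h.trans_le (mul_le_mul_of_nonneg_left hpow C.gap_pos.le)).not_ge
        (C.gap_mul_ratio_le_abs_sub hβ hne)
    rintro (_ | q) hq
    · exact hhead
    · refine ih (ω := fun q => ω (q + 1)) (ω' := fun q => ω' (q + 1)) ?_ q (by omega)
      rw [C.point_eq_branch hβ ω, C.point_eq_branch hβ ω', hhead, C.branch_sub_branch, abs_mul,
        abs_of_pos hratio, pow_succ, ← mul_assoc] at h
      exact lt_of_mul_lt_mul_right h hratio.le

end BlockCode

/-- The word `w 0 … w (L - 1) 1 0 0 …`, which differs from the zero word at `L` whatever `w` is. -/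
def markedWord (L : ℕ) (w : ℕ → ℤ) (i : ℕ) : ℤ :=
  if i < L then w i else if i = L then 1 else 0

lemma markedWord_of_lt {L i : ℕ} (w : ℕ → ℤ) (hi : i < L) : markedWord L w i = w i := if_pos hi

lemma markedWord_add (L : ℕ) (w : ℕ → ℤ) (i : ℕ) :
    markedWord L w (L + i) = Pi.single (M := fun _ => ℤ) 0 1 i := by
  simp [markedWord, Pi.single_apply]

lemma IsFull.markedWord (hβ : 0 < β) {L j : ℕ} (hw : IsFull β L w)
    (hj : IsFull β (j + 1) (Pi.single 0 1)) : IsFull β (L + (j + 1)) (markedWord L w) :=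
  IsFull.append hβ (IsFullUpTo.congr hw fun _ hi => (markedWord_of_lt w hi).symm)
    (hj.congr fun i _ => (markedWord_add L w i).symm)

/-- The block code that codes `a` by `φ a`, followed by the digit `1` as mark and by `j + 1` zeros.
The last zero keeps the cylinder away from `1`. -/
def BlockCode.ofFullWords {α : Type*} (hβ : 1 < β) {L j : ℕ} (φ : α → ℕ → ℤ)
    (hφ : ∀ a, IsFull β L (φ a)) (hinj : ∀ a b, (∀ i < L, φ a i = φ b i) → a = b)
    (hj : IsFull β (j + 1) (Pi.single 0 1)) : BlockCode β α where
  len := L + (j + 1) + 1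
  mark := L
  mark_lt := by omega
  word o := o.elim 0 fun a => markedWord L (φ a)
  isFull := by
    rintro (_ | a)
    · exact isFull_zero hβ.le _
    · refine ((hφ a).markedWord (by linarith) hj).succ (by linarith) ?_ le_rfl ?_ <;>
        simp [markedWord_add, hβ.le]
  branch_one_lt_one := by
    rintro (_ | a)
    · exact (isFull_zero hβ.le _).branch_succ_one_lt_one hβ rfl
    · exact ((hφ a).markedWord (by linarith) hj).branch_succ_one_lt_one hβ
        (by simp [markedWord_add])
  word_none := rfl
  word_some_mark a := by simp [markedWord]
  eq_of_word_some_eq a b h := hinj a b fun i hi => by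
    simpa [markedWord, hi] using h i (by omega)

lemma eventually_add_one_lt_mul_pow {ρ c : ℝ} (hρ : 1 < ρ) (hc : 0 < c) :
    ∀ᶠ n : ℕ in atTop, (n + 1 : ℝ) < c * ρ ^ n := by
  have hn := (tendsto_pow_const_div_const_pow_of_one_lt 1 hρ).add
    (tendsto_pow_const_div_const_pow_of_one_lt 0 hρ)
  rw [add_zero] at hn
  filter_upwards [hn.eventually_lt_const hc] with n hn
  rwa [← add_div, pow_one, pow_zero, div_lt_iff₀ (by positivity)] at hn

lemma exists_blockCode_len_eq_add (hβ : 1 < β) :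
    ∃ c, ∀ L, ∃ (N : ℕ) (C : BlockCode β (Fin N)), C.len = L + c ∧ β ^ L ≤ (L + 1) * N := by
  obtain ⟨j, hj⟩ := exists_isFull_single_one hβ
  refine ⟨j + 2, fun L => ?_⟩
  have := (fullWords_finite (by linarith : 0 ≤ β) L).to_subtype
  let e := (Finite.equivFin (fullWords β L)).symm
  have hinj : ∀ a b, (∀ i < L, (e a : ℕ → ℤ) i = (e b : ℕ → ℤ) i) → a = b := by
    refine fun a b h => e.injective (Subtype.ext (funext fun i => ?_))
    rcases lt_or_ge i L with hi | hi
    · exact h i hi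
    · rw [(e a).2.2 i hi, (e b).2.2 i hi]
  exact ⟨_, BlockCode.ofFullWords hβ (fun a => e a) (fun a => (e a).2.1) hinj hj, rfl,
    pow_le_mul_ncard_fullWords hβ.le L⟩

lemma exists_blockCode (hβ : 1 < β) {r : ℝ} (hr : r < 1) :
    ∃ (N : ℕ) (C : BlockCode β (Fin N)), 1 ≤ N * C.ratio ^ r := by
  have hβ0 : 0 < β := by linarith
  obtain ⟨c, hc⟩ := exists_blockCode_len_eq_add hβ
  obtain ⟨L, hL⟩ := (eventually_add_one_lt_mul_pow (Real.one_lt_rpow hβ (sub_pos.2 hr))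
    (Real.rpow_pos_of_pos hβ0 (-(c * r)))).exists
  obtain ⟨N, C, hlen, hN⟩ := hc L
  have hratio : β ^ (-(c * r)) * (β ^ (1 - r)) ^ L = β ^ L * C.ratio ^ r := by
    rw [BlockCode.ratio, hlen, inv_pow, ← Real.rpow_natCast, ← Real.rpow_natCast,
      ← Real.rpow_natCast, ← Real.rpow_neg hβ0.le, ← Real.rpow_mul hβ0.le, ← Real.rpow_mul hβ0.le,
      ← Real.rpow_add hβ0, ← Real.rpow_add hβ0]
    congr 1
    push_cast
    ring
  refine ⟨N, C, le_of_mul_le_mul_left ?_ (by positivity : (0 : ℝ) < L + 1)⟩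
  calc (L + 1 : ℝ) * 1 ≤ β ^ L * C.ratio ^ r := by rw [mul_one, ← hratio]; exact hL.le
    _ ≤ (L + 1) * N * C.ratio ^ r :=
      mul_le_mul_of_nonneg_right hN (Real.rpow_nonneg (C.ratio_pos hβ0).le r)
    _ = (L + 1) * (N * C.ratio ^ r) := mul_assoc _ _ _

/-! ### Sources containing copies of the prefixes of a target -/

/-- The blocks `[p k, p k + k + 4)` follow one another with gaps in between. -/
def IsSparse (p : ℕ → ℕ) : Prop := ∀ k, p k + k + 5 ≤ p (k + 1)

/-- The places `p k, …, p k + k + 3` for all `k`: they will carry the `k`-th copy. -/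
def place (p : ℕ → ℕ) (c : Σ k, Fin (k + 4)) : ℕ := p c.1 + c.2

open Classical in
/-- The number of places below `n` that carry no copy. -/
def freeCount (p : ℕ → ℕ) (n : ℕ) : ℕ := Nat.count (· ∉ range (place p)) n

/-- The sequence `v`, preceded by two blanks. -/
def targetSeq {α : Type*} (v : ℕ → α) (q : ℕ) : Option α := if q < 2 then none else some (v (q - 2))

/-- The sequence that contains, at `p k` for every `k`, the first `k + 3` letters of `targetSeq v`
followed by a blank; the remaining places are filled with `u`. -/
def sourceSeq {α : Type*} (p : ℕ → ℕ) (u v : ℕ → α) : ℕ → Option α :=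
  Function.extend (place p) (fun c => if (c.2 : ℕ) = c.1 + 3 then none else targetSeq v c.2)
    fun q => some (u (freeCount p q))

section Sequences

variable {α : Type*} {p : ℕ → ℕ} {u u' v v' : ℕ → α} {D i k l q : ℕ}

lemma targetSeq_eq_none_iff : targetSeq v q = none ↔ q < 2 := by simp [targetSeq]

lemma eq_of_targetSeq_eq (h : ∀ q < n, targetSeq v q = targetSeq v' q) :
    ∀ i < n - 2, v i = v' i := fun i hi => by
  simpa [targetSeq] using h (i + 2) (by omega)

lemma IsSparse.add_le_of_lt (hp : IsSparse p) (h : k < l) : p k + k + 5 ≤ p l := by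
  induction l, h using Nat.le_induction with
  | base => exact hp k
  | succ l _ ih => linarith [hp l]

lemma IsSparse.strictMono (hp : IsSparse p) : StrictMono p := fun k _ h => by
  linarith [hp.add_le_of_lt h]

lemma IsSparse.place_injective (hp : IsSparse p) : Function.Injective (place p) := by
  rintro ⟨k, i, hi⟩ ⟨l, j, hj⟩ (h : p k + i = p l + j)
  rcases lt_trichotomy k l with hkl | rfl | hkl
  · linarith [hp.add_le_of_lt hkl]
  · obtain rfl := Nat.add_left_cancel h
    rfl
  · linarith [hp.add_le_of_lt hkl]

lemma sourceSeq_copy (hp : IsSparse p) (hi : i < k + 3) :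
    sourceSeq p u v (p k + i) = targetSeq v i :=
  (hp.place_injective.extend_apply _ _ ⟨k, i, by omega⟩).trans (if_neg hi.ne)

lemma sourceSeq_copy_end (hp : IsSparse p) (k : ℕ) : sourceSeq p u v (p k + (k + 3)) = none :=
  (hp.place_injective.extend_apply _ _ ⟨k, k + 3, by omega⟩).trans (if_pos rfl)

lemma sourceSeq_of_notMem (h : q ∉ range (place p)) :
    sourceSeq p u v q = some (u (freeCount p q)) :=
  Function.extend_apply' _ _ _ h

lemma exists_of_sourceSeq_eq_none (hp : IsSparse p) (h : sourceSeq p u v q = none) :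
    ∃ k, q = p k ∨ q = p k + 1 ∨ q = p k + (k + 3) := by
  by_cases hq : q ∈ range (place p)
  · obtain ⟨⟨k, i, hi⟩, rfl⟩ := hq
    change sourceSeq p u v (p k + i) = none at h
    rcases eq_or_ne i (k + 3) with rfl | hne
    · exact ⟨k, .inr (.inr rfl)⟩
    · rw [sourceSeq_copy hp (by omega), targetSeq_eq_none_iff] at h
      exact ⟨k, by unfold place; simp only; omega⟩
  · simp [sourceSeq_of_notMem hq] at h

lemma exists_eq_of_sourceSeq_eq_none (hp : IsSparse p) (h : sourceSeq p u v q = none)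
    (h' : sourceSeq p u v (q + 1) = none) : ∃ k, q = p k := by
  obtain ⟨k, rfl | rfl | rfl⟩ := exists_of_sourceSeq_eq_none hp h
  · exact ⟨k, rfl⟩
  · rw [add_assoc, sourceSeq_copy hp (by omega), targetSeq_eq_none_iff] at h'
    omega
  · obtain ⟨l, hl⟩ := exists_of_sourceSeq_eq_none hp h'
    rcases lt_trichotomy k l with hkl | rfl | hkl
    · have := hp.add_le_of_lt hkl
      omega
    · omega
    · have := hp.add_le_of_lt hkl
      omega

lemma freeCount_succ_of_notMem (h : q ∉ range (place p)) :
    freeCount p (q + 1) = freeCount p q + 1 := by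
  classical
  rw [freeCount, Nat.count_succ, if_pos h, freeCount]

lemma freeCount_succ_of_mem (h : q ∈ range (place p)) : freeCount p (q + 1) = freeCount p q := by
  classical
  rw [freeCount, Nat.count_succ, if_neg (not_not.2 h), freeCount, add_zero]

lemma eq_of_sourceSeq_eq (h : ∀ q < n, sourceSeq p u v q = sourceSeq p u' v' q) :
    ∀ i < freeCount p n, u i = u' i := by
  induction n with
  | zero => simp [freeCount]
  | succ n ih =>
    intro i hi
    have hinit := ih fun q hq => h q (by omega)
    by_cases hn : n ∈ range (place p)
    · exact hinit i (freeCount_succ_of_mem hn ▸ hi)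
    · rw [freeCount_succ_of_notMem hn] at hi
      rcases Nat.lt_succ_iff_lt_or_eq.1 hi with hi | rfl
      · exact hinit i hi
      · simpa [sourceSeq_of_notMem hn] using h n n.lt_succ_self

open Classical in
lemma mul_card_filter_mem_range_place_le (hD : 0 < D) (hp : ∀ k, D * (k + 2) ^ 2 ≤ p k) (n : ℕ) :
    D * ((Finset.range n).filter (· ∈ range (place p))).card ≤ 4 * n := by
  set s := Nat.sqrt (n / D)
  have hsub : (Finset.range n).filter (· ∈ range (place p)) ⊆
      ((Finset.range s).sigma fun k => (Finset.univ : Finset (Fin (k + 4)))).image (place p) := by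
    intro q hq
    obtain ⟨hqn, ⟨k, i⟩, rfl⟩ := Finset.mem_filter.1 hq
    refine Finset.mem_image_of_mem _ (Finset.mem_sigma.2 ⟨?_, Finset.mem_univ _⟩)
    have hk : (k + 2) ^ 2 ≤ n / D := (Nat.le_div_iff_mul_le hD).2 <|
      (mul_comm D _ ▸ hp k).trans ((Nat.le_add_right _ _).trans (Finset.mem_range.1 hqn).le)
    exact Finset.mem_range.2 ((Nat.lt_add_of_pos_right two_pos).trans_le (Nat.le_sqrt'.2 hk))
  have hcard : ((Finset.range n).filter (· ∈ range (place p))).card ≤ s * (4 * s) := by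
    refine (Finset.card_le_card hsub).trans (Finset.card_image_le.trans ?_)
    rw [Finset.card_sigma]
    refine (Finset.sum_le_card_nsmul _ _ (4 * s) fun k hk => ?_).trans_eq (by simp)
    rw [Finset.card_univ, Fintype.card_fin]
    have := Finset.mem_range.1 hk
    omega
  calc D * _ ≤ D * (s * (4 * s)) := Nat.mul_le_mul_left D hcard
    _ = 4 * (s * s * D) := by ring
    _ ≤ 4 * n := Nat.mul_le_mul_left 4 <|
      (Nat.mul_le_mul_right D (Nat.sqrt_le _)).trans (Nat.div_mul_le_self n D)

lemma mul_le_freeCount (hD : 0 < D) (hp : ∀ k, D * (k + 2) ^ 2 ≤ p k) {r : ℝ}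
    (hr : 4 ≤ D * (1 - r)) (n : ℕ) : n * r ≤ freeCount p n := by
  classical
  have hsum := Finset.card_filter_add_card_filter_not (s := Finset.range n) (· ∈ range (place p))
  have hres := mul_card_filter_mem_range_place_le hD hp n
  rw [freeCount, Nat.count_eq_card_filter_range]
  rw [Finset.card_range] at hsum
  rify at hsum hres hD
  have hmul := mul_le_mul_of_nonneg_right hr n.cast_nonneg
  refine le_of_mul_le_mul_left ?_ hD
  linear_combination hmul + hres - D * hsum

end Sequences

/-! ### Waiting times -/

lemma waitingTime_le {k : ℕ} (hk : 1 ≤ k) (h : (T β)^[k] x ∈ basicInterval β n y) :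
    waitingTime β n x y ≤ k :=
  sInf_le ⟨k, ⟨hk, h⟩, rfl⟩

lemma le_waitingTime {w : ℕ∞} (h : ∀ k : ℕ, (T β)^[k] x ∈ basicInterval β n y → w ≤ k) :
    w ≤ waitingTime β n x y := by
  refine le_sInf ?_
  rintro _ ⟨k, ⟨-, hk⟩, rfl⟩
  exact h k hk

lemma waitingRate_eq {w : ℕ} (h : waitingTime β n x y = w) (hw : 0 < w) :
    waitingRate β x y n = ((Real.log w / n : ℝ) : EReal) := by
  rw [waitingRate, h, ENat.toENNReal_coe, ← ENNReal.ofReal_natCast,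
    ENNReal.log_ofReal_of_pos (Nat.cast_pos.2 hw), EReal.coe_div, EReal.coe_natCast]

namespace BlockCode

variable {α : Type*} (C : BlockCode β α) {ω ω' : ℕ → Option α} {p : ℕ → ℕ} {u v : ℕ → α} {k : ℕ}

lemma iterate_T_point_mem_basicInterval_iff (hβ : 1 < β) :
    (T β)^[k] (C.point ω) ∈ basicInterval β n (C.point ω') ↔
      ∀ i < n, C.concat ω (k + i) = C.concat ω' i := by
  simp only [mem_basicInterval_iff, expansion_iterate_T, C.expansion_point hβ,
    iterate_T_mem_Ico β (C.point_mem_Ico hβ ω) k, true_and]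

lemma exists_eq_none_of_concat_eq_zero (h : ∀ i < C.len, C.concat ω (k + i) = 0) :
    ∃ q, ω q = none ∧ C.len * q + C.mark ∈ Ico k (k + C.len) := by
  have hmark := C.mark_lt
  set q := (k + (C.len - 1 - C.mark)) / C.len
  have hdiv : C.len * q ≤ _ := Nat.mul_div_le (k + (C.len - 1 - C.mark)) C.len
  have hlt : _ < C.len * q + C.len := Nat.lt_mul_div_succ (k + (C.len - 1 - C.mark)) C.len_pos
  have hmem : C.len * q + C.mark ∈ Ico k (k + C.len) := ⟨by omega, by omega⟩
  refine ⟨q, C.concat_mark_eq_zero_iff.1 ?_, hmem⟩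
  obtain ⟨i, hi⟩ := Nat.exists_eq_add_of_le hmem.1
  rw [hi]
  exact h i (by have := hmem.2; omega)

lemma concat_eq_zero {i : ℕ} (h : ω (i / C.len) = none) : C.concat ω i = 0 := by
  rw [concat, h, word_none, Pi.zero_apply]

lemma concat_sourceSeq_copy (hp : IsSparse p) {i : ℕ} (hi : i < C.len * (k + 3)) :
    C.concat (sourceSeq p u v) (C.len * p k + i) = C.concat (targetSeq v) i := by
  rw [concat_len_mul_add]
  exact C.concat_congr (fun q hq => sourceSeq_copy hp hq) hi

/-- The two blanks that start the target can only be matched at the start of a copy, and the blank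
that ends the copy bounds the length of the match. -/
lemma exists_copy_of_concat_eq (hp : IsSparse p) {s : ℕ} (hn : 2 ≤ n)
    (h : ∀ i < C.len * n, C.concat (sourceSeq p u v) (s + i) = C.concat (targetSeq v) i) :
    ∃ k, n ≤ k + 4 ∧ C.len * p k < s + C.len := by
  have hlen := C.len_pos
  have hlen2 : C.len * 2 ≤ C.len * n := Nat.mul_le_mul_left _ hn
  have hzero : ∀ i < C.len * 2, C.concat (sourceSeq p u v) (s + i) = 0 := fun i hi => by
    rw [h i (by omega), C.concat_eq_zero (targetSeq_eq_none_iff.2 (Nat.div_lt_of_lt_mul hi))]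
  obtain ⟨q, hq, hqs, hqs'⟩ := C.exists_eq_none_of_concat_eq_zero fun i hi => hzero i (by omega)
  have hq' : sourceSeq p u v (q + 1) = none := by
    rw [← C.concat_mark_eq_zero_iff, Nat.mul_succ]
    convert hzero (C.len * q + C.mark + C.len - s) (by omega) using 2
    omega
  obtain ⟨k, rfl⟩ := exists_eq_of_sourceSeq_eq_none hp hq hq'
  refine ⟨k, ?_, by omega⟩
  by_contra! hk
  have hlenk : C.len * (k + 5) ≤ C.len * n := Nat.mul_le_mul_left _ hk
  have hmark := C.mark_lt
  obtain ⟨o, ho⟩ := Nat.exists_eq_add_of_le (show s ≤ C.len * (p k + (k + 3)) by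
    rw [mul_add, mul_add]; omega)
  have hend : ∀ i < C.len, C.concat (targetSeq v) (o + i) = 0 := fun i hi => by
    rw [← h (o + i) (by simp only [mul_add] at ho hlenk; omega), ← add_assoc, ← ho,
      concat_len_mul_add, C.concat_eq_zero]
    rw [Nat.div_eq_of_lt hi]
    exact sourceSeq_copy_end hp k
  obtain ⟨q, hq, hqo, -⟩ := C.exists_eq_none_of_concat_eq_zero hend
  have hq2 : C.len * q ≤ C.len * 1 :=
    Nat.mul_le_mul_left _ (Nat.le_of_lt_succ (targetSeq_eq_none_iff.1 hq))
  simp only [mul_add] at ho hlenk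
  omega

lemma exists_waitingTime_eq (hβ : 1 < β) (hp : IsSparse p) (hn : C.len * (k + 4) ≤ n)
    (hn' : n ≤ C.len * (k + 5)) :
    ∃ w : ℕ, waitingTime β n (C.point (sourceSeq p u v)) (C.point (targetSeq v)) = w ∧
      p k ≤ w ∧ w ≤ C.len * p (k + 2) := by
  have hupper : waitingTime β n (C.point (sourceSeq p u v)) (C.point (targetSeq v)) ≤
      (C.len * p (k + 2) : ℕ) := by
    refine waitingTime_le (Nat.mul_pos C.len_pos (by linarith [hp (k + 1)])) ?_
    exact (C.iterate_T_point_mem_basicInterval_iff hβ).2 fun i hi =>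
      C.concat_sourceSeq_copy hp (hi.trans_le hn')
  have hlower : (p k : ℕ∞) ≤
      waitingTime β n (C.point (sourceSeq p u v)) (C.point (targetSeq v)) := by
    refine le_waitingTime fun s hs => Nat.cast_le.2 ?_
    rw [C.iterate_T_point_mem_basicInterval_iff hβ] at hs
    obtain ⟨l, hl, hls⟩ := C.exists_copy_of_concat_eq hp (by omega) fun i hi =>
      hs i (hi.trans_le hn)
    have hkl : p k ≤ p l := hp.strictMono.monotone (by omega)
    by_contra! hlt
    have hmul := Nat.mul_le_mul_left C.len (Nat.succ_le_of_lt (hlt.trans_le hkl))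
    have hsle := Nat.le_mul_of_pos_left s C.len_pos
    rw [Nat.mul_succ] at hmul
    omega
  obtain ⟨w, hw⟩ := ENat.ne_top_iff_exists.1 (hupper.trans_lt (ENat.natCast_lt_top _)).ne
  rw [← hw] at hupper hlower ⊢
  exact ⟨w, rfl, Nat.cast_le.1 hlower, Nat.cast_le.1 hupper⟩

end BlockCode

/-! ### Waiting times of a prescribed rate -/

lemma tendsto_div_of_le_of_le_add {f g e : ℕ → ℝ} {c : ℕ} {a : EReal}
    (hg : Tendsto (fun n : ℕ => ((g n / n : ℝ) : EReal)) atTop (nhds a))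
    (he : Tendsto (fun n : ℕ => e n / n) atTop (nhds 0))
    (hgf : ∀ᶠ n in atTop, g n ≤ f n) (hfg : ∀ᶠ n in atTop, f n ≤ e n + g (n + c)) :
    Tendsto (fun n : ℕ => ((f n / n : ℝ) : EReal)) atTop (nhds a) := by
  have hshift : Tendsto (fun n : ℕ => (((n + c : ℕ) / n : ℝ) : EReal)) atTop (nhds 1) := by
    have h : Tendsto (fun n : ℕ => 1 + (c : ℝ) / n) atTop (nhds 1) := by
      simpa using (tendsto_const_div_atTop_nhds_zero_nat (c : ℝ)).const_add 1
    refine EReal.tendsto_coe.2 (h.congr' ?_)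
    filter_upwards [eventually_gt_atTop 0] with n hn
    rw [Nat.cast_add, add_div, div_self (Nat.cast_pos.2 hn).ne']
  have hmul : Tendsto (fun n : ℕ => ((g (n + c) / (n + c : ℕ) : ℝ) : EReal) *
      (((n + c : ℕ) / n : ℝ) : EReal)) atTop (nhds a) := by
    have hcont := EReal.continuousAt_mul (p := (a, 1)) (.inr (EReal.coe_ne_bot 1))
      (.inr (EReal.coe_ne_top 1)) (.inr one_ne_zero) (.inr one_ne_zero)
    simpa [Function.comp_def] using
      hcont.tendsto.comp (((tendsto_add_atTop_iff_nat c).2 hg).prodMk_nhds hshift)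
  have hadd := (EReal.continuousAt_add (p := (0, a)) (by simp) (by simp)).tendsto.comp
    ((EReal.tendsto_coe.2 he).prodMk_nhds hmul)
  rw [zero_add] at hadd
  refine tendsto_of_tendsto_of_tendsto_of_le_of_le' hg hadd ?_ ?_
  · filter_upwards [hgf] with n hn
    exact EReal.coe_le_coe (by gcongr)
  · filter_upwards [hfg, eventually_gt_atTop 0] with n hn hn0
    simp only [Function.comp_apply, ← EReal.coe_mul, ← EReal.coe_add]
    rw [EReal.coe_le_coe_iff, div_mul_div_cancel₀ (by positivity), ← add_div]
    gcongr

lemma exists_monotone_tendsto_div (a : ℝ≥0∞) :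
    ∃ g : ℕ → ℝ, Monotone g ∧ 0 ≤ g 0 ∧
      Tendsto (fun n : ℕ => ((g n / n : ℝ) : EReal)) atTop (nhds (a : EReal)) := by
  have hfin : ∀ n : ℕ, min a n ≠ ∞ := fun n => (min_lt_of_right_lt (ENNReal.natCast_lt_top n)).ne
  refine ⟨fun n => (min a n).toReal * n, fun m n h => ?_, by simp, ?_⟩
  · have hmin := ENNReal.toReal_mono (hfin n) (min_le_min_left a (Nat.cast_le.2 h))
    exact mul_le_mul hmin (Nat.cast_le.2 h) m.cast_nonneg ENNReal.toReal_nonneg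
  · have hmin : Tendsto (fun n : ℕ => min a (n : ℝ≥0∞)) atTop (nhds a) := by
      simpa using tendsto_const_nhds.min ENNReal.tendsto_nat_nhds_top
    refine ((continuous_coe_ennreal_ereal.tendsto a).comp hmin).congr' ?_
    filter_upwards [eventually_gt_atTop 0] with n hn
    rw [mul_div_cancel_right₀ _ (Nat.cast_pos.2 hn).ne', Function.comp_apply,
      EReal.coe_ennreal_toReal (hfin n)]

lemma exists_isSparse_log_bounds {G : ℕ → ℝ} (hG : Monotone G) (hG0 : 0 ≤ G 0) {D : ℕ}
    (hD : 0 < D) :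
    ∃ p, IsSparse p ∧ (∀ k, D * (k + 2) ^ 2 ≤ p k) ∧ ∀ k, G k ≤ Real.log (p k) ∧
      Real.log (p k) ≤ Real.log (2 * D) + 2 * Real.log (k + 2) + G k := by
  have hceil : ∀ k, 1 ≤ ⌈Real.exp (G k)⌉₊ := fun k => Nat.one_le_ceil_iff.2 (Real.exp_pos _)
  refine ⟨fun k => D * (k + 2) ^ 2 * ⌈Real.exp (G k)⌉₊, fun k => ?_,
    fun k => Nat.le_mul_of_pos_right _ (hceil k), fun k => ⟨?_, ?_⟩⟩
  · have hmono : ⌈Real.exp (G k)⌉₊ ≤ ⌈Real.exp (G (k + 1))⌉₊ :=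
      Nat.ceil_mono (Real.exp_le_exp.2 (hG k.le_succ))
    calc D * (k + 2) ^ 2 * ⌈Real.exp (G k)⌉₊ + k + 5
        ≤ D * (k + 2) ^ 2 * ⌈Real.exp (G k)⌉₊ + 1 * (2 * k + 5) * 1 := by omega
      _ ≤ D * (k + 2) ^ 2 * ⌈Real.exp (G k)⌉₊ + D * (2 * k + 5) * ⌈Real.exp (G k)⌉₊ := by
        gcongr
        exacts [hD, hceil k]
      _ = D * (k + 1 + 2) ^ 2 * ⌈Real.exp (G k)⌉₊ := by ring
      _ ≤ D * (k + 1 + 2) ^ 2 * ⌈Real.exp (G (k + 1))⌉₊ := Nat.mul_le_mul_left _ hmono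
  · have hone : 1 ≤ D * (k + 2) ^ 2 := Nat.mul_pos hD (by positivity)
    rw [Real.le_log_iff_exp_le (Nat.cast_pos.2 (Nat.mul_pos hone (hceil k)))]
    exact (Nat.le_ceil _).trans (Nat.cast_le.2 (Nat.le_mul_of_pos_left _ hone))
  · have hceil_le : (⌈Real.exp (G k)⌉₊ : ℝ) ≤ 2 * Real.exp (G k) := by
      linarith [Nat.ceil_lt_add_one (Real.exp_pos (G k)).le,
        Real.one_le_exp (hG0.trans (hG k.zero_le))]
    push_cast
    calc Real.log (D * (k + 2) ^ 2 * ⌈Real.exp (G k)⌉₊)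
        ≤ Real.log (D * (k + 2) ^ 2 * (2 * Real.exp (G k))) := by gcongr
      _ = Real.log (2 * D * (k + 2) ^ 2 * Real.exp (G k)) := by ring_nf
      _ = Real.log (2 * D) + 2 * Real.log (k + 2) + G k := by
          rw [Real.log_mul (by positivity) (Real.exp_pos _).ne',
            Real.log_mul (by positivity) (by positivity), Real.log_pow, Real.log_exp, Nat.cast_two]

lemma exists_isSparse_tendsto (a : ℝ≥0∞) {L D : ℕ} (hL : 0 < L) (hD : 0 < D) :
    ∃ p, IsSparse p ∧ (∀ k, D * (k + 2) ^ 2 ≤ p k) ∧ ∀ w : ℕ → ℕ,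
      (∀ᶠ n in atTop, ∃ k, L * (k + 4) ≤ n ∧ n ≤ L * (k + 5) ∧ p k ≤ w n ∧ w n ≤ L * p (k + 2)) →
      Tendsto (fun n : ℕ => ((Real.log (w n) / n : ℝ) : EReal)) atTop (nhds (a : EReal)) := by
  obtain ⟨g, hmono, hg0, hga⟩ := exists_monotone_tendsto_div a
  obtain ⟨p, hp, hpD, hlog⟩ := exists_isSparse_log_bounds (G := fun k => g (L * (k + 5)))
    (fun k l h => hmono (by gcongr)) (hg0.trans (hmono (Nat.zero_le _))) hD
  have hpos : ∀ k, 0 < p k := fun k => (by positivity : 0 < D * (k + 2) ^ 2).trans_le (hpD k)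
  refine ⟨p, hp, hpD, fun w hw => tendsto_div_of_le_of_le_add (c := 3 * L)
    (e := fun n => Real.log L + Real.log (2 * D) + 2 * Real.log n) hga ?_ ?_ ?_⟩
  · have hconst := tendsto_const_div_atTop_nhds_zero_nat (Real.log L + Real.log (2 * D))
    have hlogn : Tendsto (fun n : ℕ => Real.log n / n) atTop (nhds 0) :=
      Real.isLittleO_log_id_atTop.tendsto_div_nhds_zero.comp tendsto_natCast_atTop_atTop
    simpa [add_div, mul_div_assoc] using hconst.add (hlogn.const_mul 2)
  · filter_upwards [hw] with n ⟨k, _, hn, hkw, _⟩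
    calc g n ≤ g (L * (k + 5)) := hmono hn
      _ ≤ Real.log (p k) := (hlog k).1
      _ ≤ Real.log (w n) := Real.log_le_log (Nat.cast_pos.2 (hpos k)) (Nat.cast_le.2 hkw)
  · filter_upwards [hw] with n ⟨k, hn, _, hkw, hwk⟩
    have hkn : ((k + 2 : ℕ) + 2 : ℝ) ≤ n := by
      exact_mod_cast (Nat.le_mul_of_pos_left (k + 4) hL).trans hn
    calc Real.log (w n) ≤ Real.log (L * p (k + 2)) :=
          Real.log_le_log (Nat.cast_pos.2 ((hpos k).trans_le hkw)) (by exact_mod_cast hwk)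
      _ = Real.log L + Real.log (p (k + 2)) :=
          Real.log_mul (Nat.cast_pos.2 hL).ne' (Nat.cast_pos.2 (hpos _)).ne'
      _ ≤ Real.log L + (Real.log (2 * D) + 2 * Real.log ((k + 2 : ℕ) + 2) +
            g (L * (k + 2 + 5))) := by gcongr; exact (hlog (k + 2)).2
      _ ≤ Real.log L + (Real.log (2 * D) + 2 * Real.log n + g (n + 3 * L)) := by
          have hgn : g (L * (k + 2 + 5)) ≤ g (n + 3 * L) := hmono (by linarith)
          gcongr
      _ = _ := by ring

namespace BlockCode

variable {α : Type*} (C : BlockCode β α) {p : ℕ → ℕ}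

/-- The points coded by a source and by its target. -/
def pair (p : ℕ → ℕ) (b : (ℕ → α) × (ℕ → α)) : EuclideanSpace ℝ (Fin 2) :=
  !₂[C.point (sourceSeq p b.1 b.2), C.point (targetSeq b.2)]

lemma eventually_exists_waitingTime_eq (hβ : 1 < β) (hp : IsSparse p) (u v : ℕ → α) :
    ∀ᶠ n in atTop, ∃ (w k : ℕ),
      waitingTime β n (C.point (sourceSeq p u v)) (C.point (targetSeq v)) = w ∧
      C.len * (k + 4) ≤ n ∧ n ≤ C.len * (k + 5) ∧ p k ≤ w ∧ w ≤ C.len * p (k + 2) := by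
  filter_upwards [eventually_ge_atTop (4 * C.len)] with n hn
  obtain ⟨k, hk⟩ := Nat.exists_eq_add_of_le' ((Nat.le_div_iff_mul_le C.len_pos).2 hn)
  have hkn : C.len * (k + 4) ≤ n := hk ▸ Nat.mul_div_le n C.len
  have hnk : n ≤ C.len * (k + 5) := by
    simpa only [hk] using (Nat.lt_mul_div_succ n C.len_pos).le
  obtain ⟨w, hw, hkw, hwk⟩ := C.exists_waitingTime_eq (u := u) (v := v) hβ hp hkn hnk
  exact ⟨w, k, hw, hkn, hnk, hkw, hwk⟩

lemma exists_range_pair_subset_levelSet (hβ : 1 < β) (a : ℝ≥0∞) {D : ℕ} (hD : 0 < D) :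
    ∃ p, (∀ k, D * (k + 2) ^ 2 ≤ p k) ∧ range (C.pair p) ⊆ levelSet β a := by
  obtain ⟨p, hp, hpD, hrate⟩ := exists_isSparse_tendsto a C.len_pos hD
  refine ⟨p, hpD, ?_⟩
  rintro _ ⟨⟨u, v⟩, rfl⟩
  obtain ⟨w, hw⟩ := (C.eventually_exists_waitingTime_eq hβ hp u v).choice
  have hlim : Tendsto (waitingRate β (C.point (sourceSeq p u v)) (C.point (targetSeq v))) atTop
      (nhds (a : EReal)) := by
    refine (hrate w (hw.mono fun n ⟨k, _, hk⟩ => ⟨k, hk⟩)).congr' ?_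
    filter_upwards [hw] with n ⟨k, hwn, _, _, hk, _⟩
    have hpos : 0 < p k := (by positivity : 0 < D * (k + 2) ^ 2).trans_le (hpD k)
    exact (waitingRate_eq hwn (hpos.trans_le hk)).symm
  exact ⟨C.point_mem_Ico hβ _, C.point_mem_Ico hβ _, hlim.liminf_eq, hlim.limsup_eq⟩

end BlockCode

/-! ### Hausdorff dimension -/

lemma le_mul_rpow_of_le_pow {d e c ρ K r : ℝ} (hc : 0 < c) (hρ : 0 < ρ) (hρ1 : ρ < 1) (hr : 0 < r)
    (he : 0 ≤ e) (hK : 0 ≤ K) (hdK : d ≤ K) (h : ∀ n : ℕ, e ≤ c * ρ ^ n → d ≤ K * (ρ ^ r) ^ n) :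
    d ≤ K * ((c * ρ)⁻¹ * e) ^ r := by
  have hcρ : 0 < c * ρ := mul_pos hc hρ
  have hpow : ∀ n : ℕ, (ρ ^ r) ^ n = (ρ ^ n) ^ r := Real.rpow_pow_comm hρ.le r
  rcases he.eq_or_lt with rfl | he
  · have hlim : Tendsto (fun n : ℕ => K * (ρ ^ r) ^ n) atTop (nhds 0) := by
      simpa using (tendsto_pow_atTop_nhds_zero_of_lt_one (by positivity)
        (Real.rpow_lt_one hρ.le hρ1 hr)).const_mul K
    exact (ge_of_tendsto' hlim fun n => h n (by positivity)).trans (by positivity)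
  rcases le_or_gt e c with hec | hec
  · obtain ⟨n, hn, hn'⟩ :=
      exists_nat_pow_near_of_lt_one (div_pos he hc) ((div_le_one hc).2 hec) hρ hρ1
    rw [div_le_iff₀' hc] at hn'
    rw [lt_div_iff₀' hc, pow_succ', ← mul_assoc, ← lt_inv_mul_iff₀ hcρ] at hn
    calc d ≤ K * (ρ ^ n) ^ r := hpow n ▸ h n hn'
      _ ≤ K * ((c * ρ)⁻¹ * e) ^ r := by gcongr
  · have hone : 1 ≤ (c * ρ)⁻¹ * e := by
      rw [le_inv_mul_iff₀ hcρ, mul_one]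
      exact (mul_le_of_le_one_right hc.le hρ1.le).trans hec.le
    exact hdK.trans (le_mul_of_one_le_right hK (Real.one_le_rpow hone hr.le))

lemma dimH_range_le_of_edist_le {ι X Y : Type*} [EMetricSpace X] [EMetricSpace Y] {f : ι → X}
    {g : ι → Y} {A r : NNReal} (hr : 0 < r)
    (h : ∀ a b, edist (g a) (g b) ≤ A * edist (f a) (f b) ^ (r : ℝ)) :
    dimH (range g) ≤ dimH (range f) / r := by
  rcases isEmpty_or_nonempty ι with _ | _
  · simp [range_eq_empty g]
  have hfactor : ∀ a, g (Function.invFun f (f a)) = g a := fun a => by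
    refine edist_le_zero.1 ((h _ a).trans_eq ?_)
    rw [Function.invFun_eq (f := f) ⟨a, rfl⟩, edist_self,
      ENNReal.zero_rpow_of_pos (NNReal.coe_pos.2 hr), mul_zero]
  have hholder : HolderOnWith A r (g ∘ Function.invFun f) (range f) := by
    rintro _ ⟨a, rfl⟩ _ ⟨b, rfl⟩
    simpa only [Function.comp_apply, hfactor] using h a b
  have himage : (g ∘ Function.invFun f) '' range f = range g := by
    rw [← range_comp]
    exact congrArg range (funext hfactor)
  exact himage ▸ hholder.dimH_image_le hr

lemma dimH_range_le_of_dist_le_pow {ι X Y : Type*} [MetricSpace X] [MetricSpace Y] {f : ι → X}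
    {g : ι → Y} {c ρ K : ℝ} {r : NNReal} (hc : 0 < c) (hρ : 0 < ρ) (hρ1 : ρ < 1) (hr : 0 < r)
    (hK : ∀ a b, dist (g a) (g b) ≤ K)
    (h : ∀ a b (n : ℕ), dist (f a) (f b) ≤ c * ρ ^ n →
      dist (g a) (g b) ≤ K * (ρ ^ (r : ℝ)) ^ n) :
    dimH (range g) ≤ dimH (range f) / r := by
  rcases isEmpty_or_nonempty ι with _ | ⟨⟨i⟩⟩
  · simp [range_eq_empty g]
  have hK0 : 0 ≤ K := dist_nonneg.trans (hK i i)
  refine dimH_range_le_of_edist_le (A := (K * (c * ρ)⁻¹ ^ (r : ℝ)).toNNReal) hr fun a b => ?_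
  rw [edist_dist, edist_dist, ENNReal.ofReal_rpow_of_nonneg dist_nonneg r.coe_nonneg,
    ENNReal.ofNNReal_toNNReal, ← ENNReal.ofReal_mul (by positivity)]
  have hle := le_mul_rpow_of_le_pow hc hρ hρ1 (NNReal.coe_pos.2 hr) dist_nonneg hK0 (hK a b) (h a b)
  refine ENNReal.ofReal_le_ofReal (hle.trans_eq ?_)
  rw [Real.mul_rpow (by positivity) dist_nonneg, ← mul_assoc]

lemma dimH_range_prodMap_ofDigits {N : ℕ} (hN : 1 < N) :
    dimH (range (Prod.map Real.ofDigits Real.ofDigits : (ℕ → Fin N) × (ℕ → Fin N) → ℝ × ℝ)) =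
      2 := by
  have hIcc : Icc (0 : ℝ) 1 ⊆ range (Real.ofDigits : (ℕ → Fin N) → ℝ) := fun x hx => by
    obtain ⟨a, -, ha⟩ := Real.ofDigits_SurjOn hN hx
    exact ⟨a, ha⟩
  rw [Real.dimH_of_nonempty_interior, Module.finrank_prod, Module.finrank_self]
  · norm_num
  · rw [range_prodMap, interior_prod_eq]
    have hinterior : (interior (range (Real.ofDigits : (ℕ → Fin N) → ℝ))).Nonempty :=
      (interior_Icc (a := (0 : ℝ)) (b := 1) ▸ nonempty_Ioo.2 one_pos).mono (interior_mono hIcc)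
    exact hinterior.prod hinterior

lemma inv_pow_le_mul_rpow_pow {b ρ r : ℝ} {m n : ℕ} (hb : 0 < b) (hρ : 0 < ρ) (hρ1 : ρ ≤ 1)
    (hr : 0 ≤ r) (h : 1 ≤ b * ρ ^ r) (hmn : n * r ≤ m + 2) :
    (b ^ m)⁻¹ ≤ b ^ 2 * (ρ ^ (r * r)) ^ n := by
  have hinv : b⁻¹ ≤ ρ ^ r := (inv_le_iff_one_le_mul₀' hb).2 h
  calc
    (b ^ m)⁻¹ = b ^ 2 * b⁻¹ ^ (m + 2) := by
      rw [inv_pow, pow_add]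
      field_simp
    _ ≤ b ^ 2 * (ρ ^ r) ^ (m + 2) := by gcongr
    _ ≤ b ^ 2 * (ρ ^ r) ^ (n * r) := by
      rw [← Real.rpow_natCast (ρ ^ r)]
      push_cast
      gcongr ?_ * ?_
      exact Real.rpow_le_rpow_of_exponent_ge (by positivity) (Real.rpow_le_one hρ.le hρ1 hr) hmn
    _ = b ^ 2 * (ρ ^ (r * r)) ^ n := by
      rw [← Real.rpow_natCast (ρ ^ (r * r)), ← Real.rpow_mul hρ.le, ← Real.rpow_mul hρ.le]
      ring_nf

namespace BlockCode

variable {N : ℕ} (C : BlockCode β (Fin N)) {p : ℕ → ℕ} {D : ℕ} {r : NNReal}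
  {b b' : (ℕ → Fin N) × (ℕ → Fin N)}

lemma one_lt_of_one_le_mul_ratio_rpow (hβ : 1 < β) (hr : 0 < r) (hN : 1 ≤ N * C.ratio ^ (r : ℝ)) :
    1 < N := by
  by_contra! hle
  have hratio := (C.ratio_pos (one_pos.trans hβ)).le
  have hlt := Real.rpow_lt_one hratio (C.ratio_lt_one hβ) (NNReal.coe_pos.2 hr)
  have hmul : N * C.ratio ^ (r : ℝ) ≤ C.ratio ^ (r : ℝ) :=
    mul_le_of_le_one_left (Real.rpow_nonneg hratio _) (Nat.cast_le_one.2 hle)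
  linarith

lemma eq_of_dist_pair_lt (hβ : 1 < β)
    (h : dist (C.pair p b) (C.pair p b') < C.gap * C.ratio ^ n) :
    (∀ i < freeCount p n, b.1 i = b'.1 i) ∧ ∀ i < n - 2, b.2 i = b'.2 i :=
  ⟨eq_of_sourceSeq_eq (C.eq_of_abs_point_sub_lt hβ ((PiLp.dist_apply_le _ _ 0).trans_lt h)),
    eq_of_targetSeq_eq (C.eq_of_abs_point_sub_lt hβ ((PiLp.dist_apply_le _ _ 1).trans_lt h))⟩

lemma dist_ofDigits_le (hβ : 1 < β) (hD : 0 < D) (hp : ∀ k, D * (k + 2) ^ 2 ≤ p k) (hr1 : r ≤ 1)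
    (hrD : 4 ≤ D * (1 - (r : ℝ))) (hN : 1 ≤ N * C.ratio ^ (r : ℝ))
    (h : dist (C.pair p b) (C.pair p b') < C.gap * C.ratio ^ n) :
    dist (b.map Real.ofDigits Real.ofDigits) (b'.map Real.ofDigits Real.ofDigits) ≤
      N ^ 2 * (C.ratio ^ ((r * r : NNReal) : ℝ)) ^ n := by
  have hN0 : (0 : ℝ) < N := Nat.cast_pos.2 (b.1 0).pos
  have hbound : ∀ m : ℕ, (n * r : ℝ) ≤ m + 2 →
      ((N : ℝ) ^ m)⁻¹ ≤ N ^ 2 * (C.ratio ^ ((r * r : NNReal) : ℝ)) ^ n := fun m hm =>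
    inv_pow_le_mul_rpow_pow hN0 (C.ratio_pos (by linarith)) (C.ratio_lt_one hβ).le
      r.coe_nonneg hN hm
  obtain ⟨hsource, htarget⟩ := C.eq_of_dist_pair_lt hβ h
  refine max_le ((Real.abs_ofDigits_sub_ofDigits_le hsource).trans (hbound _ ?_))
    ((Real.abs_ofDigits_sub_ofDigits_le htarget).trans (hbound _ ?_))
  · linarith [mul_le_freeCount hD hp hrD n]
  · calc (n * r : ℝ) ≤ n := mul_le_of_le_one_right n.cast_nonneg hr1
      _ ≤ (n - 2 : ℕ) + 2 := by exact_mod_cast (by omega : n ≤ n - 2 + 2)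

lemma two_mul_le_dimH_range_pair (hβ : 1 < β) (hD : 0 < D) (hp : ∀ k, D * (k + 2) ^ 2 ≤ p k)
    (hr : 0 < r) (hr1 : r ≤ 1) (hrD : 4 ≤ D * (1 - (r : ℝ))) (hN : 1 ≤ N * C.ratio ^ (r : ℝ)) :
    2 * ((r * r : NNReal) : ℝ≥0∞) ≤ dimH (range (C.pair p)) := by
  have hN1 := C.one_lt_of_one_le_mul_ratio_rpow hβ hr hN
  have hratio := C.ratio_pos (one_pos.trans hβ)
  have hrr : 0 < r * r := mul_pos hr hr
  rw [← ENNReal.le_div_iff_mul_le (.inl (ENNReal.coe_ne_zero.2 hrr.ne')) (.inl ENNReal.coe_ne_top)]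
  refine (dimH_range_prodMap_ofDigits hN1).ge.trans (dimH_range_le_of_dist_le_pow (K := N ^ 2)
    (half_pos C.gap_pos) hratio (C.ratio_lt_one hβ) hrr (fun b b' => ?_) fun b b' n h => ?_)
  · have hone : ∀ x y : ℕ → Fin N, dist (Real.ofDigits x) (Real.ofDigits y) ≤ 1 := fun x y => by
      simpa [Real.dist_eq] using
        Real.abs_ofDigits_sub_ofDigits_le (x := x) (y := y) (n := 0) (by simp)
    exact (max_le (hone _ _) (hone _ _)).trans (one_le_pow₀ (Nat.one_le_cast.2 hN1.le))
  · exact C.dist_ofDigits_le hβ hD hp hr1 hrD hN (h.trans_lt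
      (mul_lt_mul_of_pos_right (half_lt_self C.gap_pos) (pow_pos hratio n)))

end BlockCode

lemma two_mul_le_dimH_levelSet (hβ : 1 < β) (a : ℝ≥0∞) {r : NNReal} (hr : 0 < r) (hr1 : r < 1) :
    2 * ((r * r : NNReal) : ℝ≥0∞) ≤ dimH (levelSet β a) := by
  have hr1' : 0 < 1 - (r : ℝ) := sub_pos.2 hr1
  obtain ⟨N, C, hN⟩ := exists_blockCode hβ hr1
  obtain ⟨D, hD⟩ := exists_nat_ge (4 / (1 - (r : ℝ)))
  have hD0 : 0 < D := Nat.cast_pos.1 ((div_pos four_pos hr1').trans_le hD)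
  obtain ⟨p, hp, hsub⟩ := C.exists_range_pair_subset_levelSet hβ a hD0
  exact (C.two_mul_le_dimH_range_pair hβ hD0 hp hr hr1.le ((div_le_iff₀ hr1').1 hD) hN).trans
    (dimH_mono hsub)

lemma two_le_dimH_levelSet (hβ : 1 < β) (a : ℝ≥0∞) : 2 ≤ dimH (levelSet β a) := by
  have hlim : Tendsto (fun r : NNReal => 2 * ((r * r : NNReal) : ℝ≥0∞)) (nhdsWithin 1 (Iio 1))
      (nhds 2) := by
    have hcont : Continuous fun r : NNReal => 2 * ((r * r : NNReal) : ℝ≥0∞) :=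
      (ENNReal.continuous_const_mul ENNReal.ofNat_ne_top).comp
        (ENNReal.continuous_coe.comp (by fun_prop))
    simpa using (hcont.tendsto 1).mono_left nhdsWithin_le_nhds
  have : (nhdsWithin (1 : NNReal) (Iio 1)).NeBot := nhdsLT_neBot_of_exists_lt ⟨0, one_pos⟩
  refine le_of_tendsto hlim ?_
  filter_upwards [Ioo_mem_nhdsLT (one_pos : (0 : NNReal) < 1)] with r hr
  exact two_mul_le_dimH_levelSet hβ a hr.1 hr.2

end

end BetaWaiting

theorem mainTheorem2 (β : ℝ) (hβ : 1 < β) (a : ℝ≥0∞) :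
    dimH (BetaWaiting.levelSet β a) = 2 := by
  refine le_antisymm ?_ (BetaWaiting.two_le_dimH_levelSet hβ a)
  calc dimH (BetaWaiting.levelSet β a)
      ≤ dimH (univ : Set (EuclideanSpace ℝ (Fin 2))) := dimH_mono (subset_univ _)
    _ = 2 := by rw [Real.dimH_univ_eq_finrank, finrank_euclideanSpace_fin, Nat.cast_ofNat]
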